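/- For $\mu\in(0,1)$ and a positive integer $n$, let $\mathcal{P}_n^\mu$ denote the set of complex polynomials of the form $$p(x) = \zeta - \eta x^d + \sum_{n^\mu \le j \le n} a_j x^j,$$ where $\zeta\in\mathbb{C}$ with $|\zeta|=1$, $\eta\in\{0,1\}$, $d\ge 1$ is an integer, and the $a_j\in\mathbb{C}$ satisfy $|a_j|\le 1$. For every $\mu\in(0,1)$ there exists a constant $C>0$ such that for all sufficiently large $n$ (depending only on $\mu$), every $p\in\mathcal{P}_n^\mu$ and every $\rho\in[0,1]$, $$\max_{|\theta|\le n^{-2\mu}} \bigl|p(\rho e^{i\theta})\bigr| \ge \exp\left(-C\, n^\mu \log^5 n\right).$$ -/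

import Mathlib

/-- The set `𝒫_n^μ` of complex polynomials `ζ - η x^d + ∑_{n^μ ≤ j ≤ n} a_j x^j` with `|ζ| = 1`,
`η ∈ {0, 1}`, `d ≥ 1` an integer, and complex coefficients `|a_j| ≤ 1`. -/
def gapPolynomials (μ : ℝ) (n : ℕ) : Set (Polynomial ℂ) :=
  {p | ∃ (ζ η : ℂ) (d : ℕ) (a : ℕ → ℂ),
    ‖ζ‖ = 1 ∧ (η = 0 ∨ η = 1) ∧ 1 ≤ d ∧
    (∀ j : ℕ, (n : ℝ) ^ μ ≤ (j : ℝ) → j ≤ n → ‖a j‖ ≤ 1) ∧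
    p = Polynomial.C ζ - Polynomial.C η * Polynomial.X ^ d +
      ∑ j ∈ (Finset.range (n + 1)).filter (fun j : ℕ => (n : ℝ) ^ μ ≤ (j : ℝ)),
        Polynomial.C (a j) * Polynomial.X ^ j}

/-! Put `q w = p (ρ w)` and `X = n^μ`, and split `q = A + gap sum` with `A w = ζ - η (ρ w)^d`. In
the open disc `‖A w‖ ≥ 1 - ‖w‖`, so `A` is zero-free there, and `q 0 = A 0`. Where `‖w‖ ≤ exp (-δ)`
with `δ X` a sufficient multiple of `log n`, the gap sum is negligible and `q / A` is essentially
`1`.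

Compose with `W = (1 - 1/m) h`, where `h` is a self-map of the disc with `h 0 = 0` that reaches the
circle only at `1`, and set `F = (q / A) ∘ W`. The product `G z = ∏ F (ω^j z)^4` over the `m`-th
roots of unity has `G 0 = 1`, so the maximum principle gives `1 ≤ max ‖G‖` on the circle. For each
boundary `z`, at least one `ω^j z` is so close to `1` that `F` is controlled by the maximum `L` of
`‖q‖` on the arc; about `m T` others lie within `T` of `1` and get a crude polynomial bound; the
rest are at most `1 + 1/m` before the fourth power and together contribute a constant. This bounds
`L` from below (`one_le_mul_of_close_to_zero_free`).

The contact estimate `1 - ‖h z‖ ≳ ‖1 - z‖ / log²` gives `δ ≈ T / log² n`. Hence `T = log⁴ n / X`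
suffices, and `m ≈ 200 X²` matches the arc length. The crude factors number about `X log⁴ n`, each
costing `O(log n)` in the exponent, whence `log⁵`. -/

/-! ### Propagating a bound from an arc into the disc -/

open Complex in
theorem norm_pow_four_le_of_arc_bound_real {q : ℂ → ℂ} (hq : Differentiable ℂ q) {K L r : ℝ}
    (hr0 : 0 ≤ r) (hr : r < 1) (hK : ∀ w, ‖w‖ ≤ 1 → ‖q w‖ ≤ K)
    (hL : ∀ v : ℂ, ‖v‖ = 1 → ‖v - r‖ ≤ 2 * (1 - r) → ‖q v‖ ≤ L) :
    ‖q r‖ ^ 4 ≤ L * K ^ 3 := by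
  -- The product of `q` over four quarter-turns about `r` is `q r ^ 4` at the centre. At a frontier
  -- point of `U` one of the four points lies on the unit circle, within `2 (1 - r)` of `r`, so one
  -- factor is at most `L` and the other three at most `K`.
  let U : Set ℂ := {z | ∀ k : Fin 4, ‖(r : ℂ) + I ^ (k : ℕ) * z‖ < 1}
  have hcont : ∀ k : Fin 4, Continuous fun z : ℂ => ‖(r : ℂ) + I ^ (k : ℕ) * z‖ := by
    intro k; fun_prop
  have hUo : IsOpen U := by
    have : U = ⋂ k : Fin 4, {z | ‖(r : ℂ) + I ^ (k : ℕ) * z‖ < 1} := by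
      ext z; simp [U]
    rw [this]
    exact isOpen_iInter_of_finite fun k => isOpen_lt (hcont k) continuous_const
  have hUcl : closure U ⊆ {z | ∀ k : Fin 4, ‖(r : ℂ) + I ^ (k : ℕ) * z‖ ≤ 1} := by
    apply closure_minimal
    · intro z hz k; exact (hz k).le
    · have : {z : ℂ | ∀ k : Fin 4, ‖(r : ℂ) + I ^ (k : ℕ) * z‖ ≤ 1} =
          ⋂ k : Fin 4, {z | ‖(r : ℂ) + I ^ (k : ℕ) * z‖ ≤ 1} := by
        ext z; simp
      rw [this]
      exact isClosed_iInter fun k => isClosed_le (hcont k) continuous_const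
  have hbd : ∀ z ∈ closure U, ‖z‖ ≤ 2 * (1 - r) := by
    intro z hz
    have hz := hUcl hz
    have h0 : ((r : ℂ) + I ^ 0 * z).re ≤ 1 := (re_le_norm _).trans (hz 0)
    have h1 : ((r : ℂ) + I ^ 1 * z).re ≤ 1 := (re_le_norm _).trans (hz 1)
    have h2 : ((r : ℂ) + I ^ 2 * z).re ≤ 1 := (re_le_norm _).trans (hz 2)
    have h3 : ((r : ℂ) + I ^ 3 * z).re ≤ 1 := (re_le_norm _).trans (hz 3)
    simp [pow_succ] at h0 h1 h2 h3
    have hre : |z.re| ≤ 1 - r := abs_le.2 ⟨by linarith, by linarith⟩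
    have him : |z.im| ≤ 1 - r := abs_le.2 ⟨by linarith, by linarith⟩
    linarith [norm_le_abs_re_add_abs_im z]
  have hUb : Bornology.IsBounded U :=
    (Metric.isBounded_closedBall (x := (0 : ℂ)) (r := 2 * (1 - r))).subset fun z hz => by
      simpa using hbd z (subset_closure hz)
  have h0U : (0 : ℂ) ∈ U := by
    intro k; simp [abs_of_nonneg hr0, hr]
  have hK0 : 0 ≤ K := (norm_nonneg _).trans (hK 0 (by simp))
  let g : ℂ → ℂ := fun z => ∏ k : Fin 4, q ((r : ℂ) + I ^ (k : ℕ) * z)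
  have hg : Differentiable ℂ g := by
    intro z
    refine DifferentiableAt.fun_finsetProd fun k _ => ?_
    exact (hq _).comp z (by fun_prop)
  have key : ‖g 0‖ ≤ L * K ^ 3 := by
    refine Complex.norm_le_of_forall_mem_frontier_norm_le hUb hg.diffContOnCl ?_
      (subset_closure h0U)
    intro z hz
    have hzc : z ∈ closure U := frontier_subset_closure hz
    have hzn : z ∉ U := by
      rw [hUo.frontier_eq] at hz; exact hz.2
    have hz1 := hUcl hzc
    obtain ⟨k, hk⟩ : ∃ k : Fin 4, 1 ≤ ‖(r : ℂ) + I ^ (k : ℕ) * z‖ := by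
      simpa [U] using hzn
    have hkL : ‖q ((r : ℂ) + I ^ (k : ℕ) * z)‖ ≤ L := by
      apply hL _ (le_antisymm (hz1 k) hk)
      simpa using hbd z hzc
    simp only [g, norm_prod]
    rw [← Finset.mul_prod_erase _ _ (Finset.mem_univ k)]
    have : ∏ x ∈ Finset.univ.erase k, ‖q ((r : ℂ) + I ^ (x : ℕ) * z)‖ ≤ K ^ 3 := by
      refine (Finset.prod_le_prod (fun _ _ => norm_nonneg _) (fun x _ => hK _ (hz1 x))).trans ?_
      simp [Finset.card_erase_of_mem]
    exact mul_le_mul hkL this (Finset.prod_nonneg fun _ _ => norm_nonneg _)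
      ((norm_nonneg _).trans hkL)
  simpa [g] using key

/-- A bound for `q` on the part of the unit circle near `1` propagates to nearby interior points. -/
theorem norm_pow_four_le_of_arc_bound {q : ℂ → ℂ} (hq : Differentiable ℂ q) {K L a : ℝ}
    (hK : ∀ w, ‖w‖ ≤ 1 → ‖q w‖ ≤ K) (hL : ∀ v : ℂ, ‖v‖ = 1 → ‖v - 1‖ ≤ a → ‖q v‖ ≤ L)
    {w : ℂ} (hw : ‖w‖ < 1) (hwa : 3 * ‖w - 1‖ ≤ a) : ‖q w‖ ^ 4 ≤ L * K ^ 3 := by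
  set e : ℂ := Complex.exp (w.arg * Complex.I) with he
  have he1 : ‖e‖ = 1 := Complex.norm_exp_ofReal_mul_I _
  have hwe : (‖w‖ : ℂ) * e = w := Complex.norm_mul_exp_arg_mul_I w
  have hd : 1 - ‖w‖ ≤ ‖w - 1‖ := by
    have := norm_sub_norm_le (1 : ℂ) w
    rw [norm_one, norm_sub_rev] at this; exact this
  have := norm_pow_four_le_of_arc_bound_real (q := fun z => q (z * e)) (K := K) (L := L)
    (r := ‖w‖) (fun z => (hq _).comp z (by fun_prop)) (norm_nonneg _) hw
    (fun z hz => hK _ (by simpa [he1] using hz)) (fun v hv hvr => hL _ (by simpa [he1] using hv) ?_)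
  · simpa [hwe] using this
  · have h1 : v * e - 1 = (v - ‖w‖) * e + (w - 1) := by rw [sub_mul, hwe]; ring
    rw [h1]
    refine (norm_add_le _ _).trans ?_
    rw [norm_mul, he1]
    linarith

/-! ### The contact map and its boundary behaviour -/

noncomputable section
/-- The exponent of the self-map of the unit disc that touches the unit circle only at `1`. -/
def contactExponent (z : ℂ) : ℂ := -(1 - z) + (1 - z) / (3 - Complex.log (1 - z))

/-- A holomorphic self-map of the unit disc fixing `0` and `1`, whose boundary values `h z`
satisfy `1 - ‖h z‖ ≳ ‖1 - z‖ / log² ‖1 - z‖`. -/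
def boundaryContactMap (z : ℂ) : ℂ := z * Complex.exp (contactExponent z)
end

theorem two_le_re_three_sub_log {z : ℂ} (hz : ‖z‖ ≤ 1) :
    2 ≤ (3 - Complex.log (1 - z)).re := by
  have h2 : ‖1 - z‖ ≤ 2 := (norm_sub_le _ _).trans (by rw [norm_one]; linarith)
  have : Real.log ‖1 - z‖ ≤ 1 := by
    rcases (norm_nonneg (1 - z)).eq_or_lt with h | h
    · rw [← h]; simp
    · linarith [Real.log_le_sub_one_of_pos h]
  simp [Complex.log_re]; linarith

theorem norm_contactExponent_le {z : ℂ} (hz : ‖z‖ ≤ 1) :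
    ‖contactExponent z‖ ≤ 2 * ‖1 - z‖ := by
  have h := two_le_re_three_sub_log hz
  have h1 : 1 ≤ ‖3 - Complex.log (1 - z)‖ := by
    linarith [Complex.re_le_norm (3 - Complex.log (1 - z))]
  refine (norm_add_le _ _).trans ?_
  rw [norm_neg, norm_div]
  linarith [div_le_self (norm_nonneg (1 - z)) h1]

theorem one_sub_mem_slitPlane {z : ℂ} (hz : ‖z‖ ≤ 1) (h1 : z ≠ 1) :
    1 - z ∈ Complex.slitPlane := by
  left
  have hre : z.re ≤ 1 := (Complex.re_le_norm z).trans hz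
  rcases hre.lt_or_eq with h | h
  · simpa using h
  · exfalso
    apply h1
    have h2 : ‖z‖ ^ 2 ≤ 1 := pow_le_one₀ (norm_nonneg _) hz
    rw [← Complex.normSq_eq_norm_sq, Complex.normSq_apply, h] at h2
    have : z.im = 0 := by nlinarith
    exact Complex.ext (by simpa using h) (by simpa using this)

theorem differentiableAt_contactExponent {z : ℂ} (hz : ‖z‖ ≤ 1) (h1 : z ≠ 1) :
    DifferentiableAt ℂ contactExponent z := by
  have hs := one_sub_mem_slitPlane hz h1
  have h0 : 3 - Complex.log (1 - z) ≠ 0 := by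
    intro h
    have := two_le_re_three_sub_log hz
    rw [h] at this; simp at this; linarith
  unfold contactExponent
  have hd : DifferentiableAt ℂ (fun z : ℂ => 1 - z) z := by fun_prop
  exact hd.neg.add (hd.div ((hd.clog hs).const_sub 3) h0)

theorem contactExponent_one : contactExponent 1 = 0 := by simp [contactExponent]

theorem continuousOn_contactExponent :
    ContinuousOn contactExponent (Metric.closedBall 0 1) := by
  intro z hz
  have hz' : ‖z‖ ≤ 1 := by simpa using hz
  by_cases h1 : z = 1
  · subst h1
    rw [ContinuousWithinAt, contactExponent_one]
    -- The logarithm is singular at `1`, so continuity there comes from the linear bound on the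
    -- exponent.
    apply squeeze_zero_norm' (a := fun z : ℂ => 2 * ‖1 - z‖)
    · filter_upwards [self_mem_nhdsWithin] with w hw
      exact norm_contactExponent_le (by simpa using hw)
    · have : Continuous fun z : ℂ => 2 * ‖1 - z‖ := by fun_prop
      simpa using (this.tendsto 1).mono_left nhdsWithin_le_nhds
  · exact (differentiableAt_contactExponent hz' h1).continuousAt.continuousWithinAt

theorem diffContOnCl_boundaryContactMap : DiffContOnCl ℂ boundaryContactMap (Metric.ball 0 1) := by
  constructor
  · intro z hz
    have hz' : ‖z‖ < 1 := by simpa using hz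
    have h1 : z ≠ 1 := by rintro rfl; simp at hz'
    exact (differentiableAt_id.mul
      (differentiableAt_contactExponent hz'.le h1).cexp).differentiableWithinAt
  · rw [closure_ball _ one_ne_zero]
    exact continuousOn_id.mul continuousOn_contactExponent.cexp

theorem boundaryContactMap_zero : boundaryContactMap 0 = 0 := by simp [boundaryContactMap]

theorem norm_boundaryContactMap_sub_one_le {z : ℂ} (hz : ‖z‖ = 1) (h : 2 * ‖1 - z‖ ≤ 1) :
    ‖boundaryContactMap z - 1‖ ≤ 5 * ‖1 - z‖ := by
  have hE := norm_contactExponent_le hz.le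
  have h1 : boundaryContactMap z - 1 =
      z * (Complex.exp (contactExponent z) - 1) - (1 - z) := by
    unfold boundaryContactMap; ring
  have h2 := Complex.norm_exp_sub_one_le (hE.trans h)
  rw [h1]
  refine (norm_sub_le _ _).trans ?_
  rw [norm_mul, hz]
  linarith

theorem norm_one_sub_sq {z : ℂ} (hz : ‖z‖ = 1) : ‖1 - z‖ ^ 2 = 2 * (1 - z).re := by
  have h2 : ‖z‖ ^ 2 = 1 := by rw [hz]; norm_num
  rw [← Complex.normSq_eq_norm_sq, Complex.normSq_apply] at h2 ⊢
  simp; nlinarith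

theorem im_mul_arg_nonneg (u : ℂ) : 0 ≤ u.im * u.arg := by
  rcases le_total 0 u.im with h | h
  · exact mul_nonneg h (Complex.arg_nonneg_iff.2 h)
  · rcases h.lt_or_eq with h | h
    · exact mul_nonneg_of_nonpos_of_nonpos h.le (Complex.arg_neg_iff.2 h).le
    · simp [h]

/-- This is `|sin (arg u)| ≤ |arg u|`, together with `im u` and `arg u` having the same sign. -/
theorem sq_im_le_norm_mul_im_mul_arg (u : ℂ) : u.im ^ 2 ≤ ‖u‖ * (u.im * u.arg) := by
  rcases eq_or_ne u 0 with rfl | hu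
  · simp
  have hpos : 0 < ‖u‖ := norm_pos_iff.2 hu
  have hs : |u.im| ≤ ‖u‖ * |u.arg| := by
    have := Real.abs_sin_le_abs (x := u.arg)
    rw [Complex.sin_arg, abs_div, abs_of_pos hpos, div_le_iff₀ hpos] at this
    linarith
  calc u.im ^ 2 = |u.im| * |u.im| := by rw [← abs_mul, abs_of_nonneg (mul_self_nonneg _), sq]
    _ ≤ |u.im| * (‖u‖ * |u.arg|) := by gcongr
    _ = ‖u‖ * |u.im * u.arg| := by rw [abs_mul]; ring
    _ = _ := by rw [abs_of_nonneg (im_mul_arg_nonneg u)]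

theorem re_contactExponent (z : ℂ) :
    (contactExponent z).re = -(1 - z).re + ((1 - z).re * (3 - Real.log ‖1 - z‖) -
      (1 - z).im * (1 - z).arg) / ((3 - Real.log ‖1 - z‖) ^ 2 + (1 - z).arg ^ 2) := by
  unfold contactExponent
  rw [Complex.add_re, Complex.div_re, Complex.normSq_apply]
  simp only [Complex.neg_re, Complex.sub_re (3 : ℂ), Complex.sub_im (3 : ℂ), Complex.log_re,
    Complex.log_im, Complex.re_ofNat, Complex.im_ofNat]
  ring

/-- On the circle `Re (1 - z)` is only quadratic in `‖1 - z‖`, while the `im * arg` term is of order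
`‖1 - z‖ / log²` near `1` and supplies the decay. The summand `-(1 - z)` in the exponent is there to
absorb the positive real part of the quotient: since `3 - log ‖1 - z‖ ≥ 2`, half of it is enough. -/
theorem re_contactExponent_le {z : ℂ} (hz : ‖z‖ = 1) :
    (contactExponent z).re ≤ -(1 - z).re / 2 - (1 - z).im * (1 - z).arg /
      ((3 - Real.log ‖1 - z‖) ^ 2 + (1 - z).arg ^ 2) := by
  have hl := two_le_re_three_sub_log hz.le
  have hre : 0 ≤ (1 - z).re := by have := norm_one_sub_sq hz; nlinarith [sq_nonneg ‖1 - z‖]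
  rw [Complex.sub_re, Complex.log_re, Complex.re_ofNat] at hl
  rw [re_contactExponent, sub_div]
  set l := 3 - Real.log ‖1 - z‖
  have : (1 - z).re * l / (l ^ 2 + (1 - z).arg ^ 2) ≤ (1 - z).re / 2 := by
    rw [div_le_div_iff₀ (by positivity) (by norm_num)]
    have : l * 2 ≤ l ^ 2 + (1 - z).arg ^ 2 := by nlinarith [sq_nonneg (1 - z).arg]
    nlinarith
  linarith

theorem norm_boundaryContactMap {z : ℂ} (hz : ‖z‖ = 1) :
    ‖boundaryContactMap z‖ = Real.exp (contactExponent z).re := by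
  rw [boundaryContactMap, norm_mul, hz, one_mul, Complex.norm_exp]

theorem norm_boundaryContactMap_le_one_of_norm_eq_one {z : ℂ} (hz : ‖z‖ = 1) :
    ‖boundaryContactMap z‖ ≤ 1 := by
  rw [norm_boundaryContactMap hz, Real.exp_le_one_iff]
  have hre : 0 ≤ (1 - z).re := by have := norm_one_sub_sq hz; nlinarith [sq_nonneg ‖1 - z‖]
  have := re_contactExponent_le hz
  have h2 : 0 ≤ (1 - z).im * (1 - z).arg /
      ((3 - Real.log ‖1 - z‖) ^ 2 + (1 - z).arg ^ 2) :=
    div_nonneg (im_mul_arg_nonneg _) (by positivity)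
  linarith

theorem norm_boundaryContactMap_le_one {z : ℂ} (hz : ‖z‖ ≤ 1) : ‖boundaryContactMap z‖ ≤ 1 := by
  refine Complex.norm_le_of_forall_mem_frontier_norm_le Metric.isBounded_ball
    diffContOnCl_boundaryContactMap (fun w hw => ?_) (z := z) ?_
  · rw [frontier_ball _ one_ne_zero] at hw
    exact norm_boundaryContactMap_le_one_of_norm_eq_one (by simpa using hw)
  · rw [closure_ball _ one_ne_zero]; simpa using hz

theorem norm_boundaryContactMap_le_exp {z : ℂ} (hz : ‖z‖ = 1) {T : ℝ} (hT0 : 0 < T) (hT1 : T ≤ 1)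
    (hT : T ≤ ‖1 - z‖) :
    ‖boundaryContactMap z‖ ≤ Real.exp (-(3 / 4 * T / ((3 - Real.log T) ^ 2 + 10))) := by
  rw [norm_boundaryContactMap hz, Real.exp_le_exp]
  have hlT : Real.log T ≤ 0 := Real.log_nonpos hT0.le hT1
  have hsq := norm_one_sub_sq hz
  have hre : 0 ≤ (1 - z).re := by nlinarith [sq_nonneg ‖1 - z‖]
  have hE := re_contactExponent_le hz
  have hpos : 0 < ‖1 - z‖ := hT0.trans_le hT
  have hl := two_le_re_three_sub_log hz.le
  rw [Complex.sub_re, Complex.log_re, Complex.re_ofNat] at hl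
  set u := 1 - z
  have hDT : 0 < (3 - Real.log T) ^ 2 + 10 := by positivity
  have hD : 0 < (3 - Real.log ‖u‖) ^ 2 + u.arg ^ 2 := by positivity
  -- For `‖u‖ ≤ 1`, `Re u = ‖u‖² / 2` leaves `im² ≥ 3/4 ‖u‖²`, and `10` exceeds `π²`. For larger
  -- `‖u‖` the term `-Re u / 2 = -‖u‖² / 4` alone suffices.
  rcases le_total ‖u‖ 1 with h1 | h1
  · have him : 3 / 4 * ‖u‖ ≤ u.im * u.arg := by
      have h3 := sq_im_le_norm_mul_im_mul_arg u
      have h4 : ‖u‖ ^ 2 = u.re ^ 2 + u.im ^ 2 := by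
        rw [← Complex.normSq_eq_norm_sq, Complex.normSq_apply]; ring
      have h5 : u.re ^ 2 ≤ ‖u‖ ^ 2 / 4 := by
        have : u.re = ‖u‖ ^ 2 / 2 := by linarith
        rw [this]
        have : ‖u‖ ^ 2 ≤ 1 := pow_le_one₀ hpos.le h1
        nlinarith [sq_nonneg ‖u‖]
      have : ‖u‖ * (3 / 4 * ‖u‖) ≤ ‖u‖ * (u.im * u.arg) := by nlinarith
      exact le_of_mul_le_mul_left this hpos
    have hDD : (3 - Real.log ‖u‖) ^ 2 + u.arg ^ 2 ≤ (3 - Real.log T) ^ 2 + 10 := by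
      have h6 : Real.log T ≤ Real.log ‖u‖ := Real.log_le_log hT0 hT
      have h7 : u.arg ^ 2 ≤ 10 := by
        have := Complex.abs_arg_le_pi u
        have hpi := Real.pi_lt_d2
        rw [← sq_abs]
        nlinarith [abs_nonneg u.arg]
      have : (3 - Real.log ‖u‖) ^ 2 ≤ (3 - Real.log T) ^ 2 :=
        pow_le_pow_left₀ (by linarith) (by linarith) 2
      linarith
    have : 3 / 4 * T / ((3 - Real.log T) ^ 2 + 10) ≤
        u.im * u.arg / ((3 - Real.log ‖u‖) ^ 2 + u.arg ^ 2) :=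
      div_le_div₀ (im_mul_arg_nonneg u) (by linarith) hD hDD
    linarith
  · have h2 : 0 ≤ u.im * u.arg / ((3 - Real.log ‖u‖) ^ 2 + u.arg ^ 2) :=
      div_nonneg (im_mul_arg_nonneg _) hD.le
    have h3 : 3 / 4 * T / ((3 - Real.log T) ^ 2 + 10) ≤ 1 / 4 := by
      rw [div_le_div_iff₀ hDT (by norm_num)]
      nlinarith [sq_nonneg (3 - Real.log T)]
    have : 1 ≤ ‖u‖ ^ 2 := one_le_pow₀ h1
    linarith

/-! ### Rotations by roots of unity -/

theorem card_filter_abs_natCast_sub_le (m : ℕ) (x : ℝ) {R : ℝ} (hR : 0 ≤ R) :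
    (((Finset.range m).filter fun j : ℕ => |(j : ℝ) - x| ≤ R).card : ℝ) ≤ 2 * R + 1 := by
  have h1 : ((Finset.range m).filter fun j : ℕ => |(j : ℝ) - x| ≤ R).card ≤
      (Finset.Icc ⌈x - R⌉ ⌊x + R⌋).card := by
    refine Finset.card_le_card_of_injOn (fun j : ℕ => (j : ℤ)) (fun j hj => ?_)
      (fun a _ b _ h => Nat.cast_injective h)
    have hj := abs_le.1 (Finset.mem_filter.1 hj).2
    simp only [Finset.coe_Icc, Set.mem_Icc, Int.ceil_le, Int.le_floor, Int.cast_natCast]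
    exact ⟨by linarith, by linarith⟩
  rw [Int.card_Icc] at h1
  have h2 : (((⌊x + R⌋ + 1 - ⌈x - R⌉).toNat : ℤ) : ℝ) ≤ 2 * R + 1 := by
    rw [Int.toNat_eq_max]
    push_cast
    exact max_le (by linarith [Int.floor_le (x + R), Int.le_ceil (x - R)]) (by linarith)
  have h3 : ((_ : ℕ) : ℝ) ≤ _ := Nat.cast_le.2 h1
  exact h3.trans (by exact_mod_cast h2)

/-- Writing `z = exp (-iα)` with `0 ≤ α < 2π` gives `x` the meaning of the fractional index at which
the rotated point would hit `1`. -/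
theorem exists_exp_pow_mul_eq {m : ℕ} (hm : 0 < m) {z : ℂ} (hz : ‖z‖ = 1) :
    ∃ x : ℝ, 0 ≤ x ∧ x < m ∧ ∀ j : ℕ,
      Complex.exp (2 * Real.pi * Complex.I / m) ^ j * z =
        Complex.exp (Complex.I * ((2 * Real.pi * (j - x) / m : ℝ) : ℂ)) := by
  have hm' : (0 : ℝ) < m := Nat.cast_pos.2 hm
  have hmc : (m : ℂ) ≠ 0 := Nat.cast_ne_zero.2 hm.ne'
  have hpi := Real.pi_pos
  have hpic : (Real.pi : ℂ) ≠ 0 := Complex.ofReal_ne_zero.2 hpi.ne'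
  obtain ⟨α, h0, h1, hα⟩ : ∃ α : ℝ, 0 ≤ α ∧ α < 2 * Real.pi ∧
      z = Complex.exp (-α * Complex.I) := by
    have hzz := Complex.norm_mul_exp_arg_mul_I z
    rw [hz, Complex.ofReal_one, one_mul] at hzz
    rcases le_or_gt z.arg 0 with h | h
    · refine ⟨-z.arg, by linarith, by linarith [Complex.neg_pi_lt_arg z], ?_⟩
      rw [Complex.ofReal_neg, neg_neg, hzz]
    · refine ⟨2 * Real.pi - z.arg, by linarith [Complex.arg_le_pi z], by linarith, ?_⟩
      have : (-((2 * Real.pi - z.arg : ℝ) : ℂ)) * Complex.I =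
          z.arg * Complex.I - 2 * Real.pi * Complex.I := by push_cast; ring
      rw [this, Complex.exp_sub, Complex.exp_two_pi_mul_I, div_one, hzz]
  refine ⟨α * m / (2 * Real.pi), by positivity, ?_, fun j => ?_⟩
  · rw [div_lt_iff₀ (by positivity)]; nlinarith
  · rw [hα, ← Complex.exp_nat_mul, ← Complex.exp_add]
    congr 1
    push_cast
    field_simp
    ring

theorem exists_norm_one_sub_exp_pow_mul_le {m : ℕ} (hm : 0 < m) {z : ℂ} (hz : ‖z‖ = 1) :
    ∃ j < m, ‖1 - Complex.exp (2 * Real.pi * Complex.I / m) ^ j * z‖ ≤ 2 * Real.pi / m := by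
  obtain ⟨x, h0, h1, hx⟩ := exists_exp_pow_mul_eq hm hz
  have hm' : (0 : ℝ) < m := Nat.cast_pos.2 hm
  refine ⟨⌊x⌋₊, (Nat.floor_lt h0).2 h1, ?_⟩
  rw [hx, norm_sub_rev]
  refine (Real.norm_exp_I_mul_ofReal_sub_one_le).trans ?_
  rw [Real.norm_eq_abs, abs_div, abs_mul, abs_of_pos hm', abs_of_pos Real.two_pi_pos]
  have : |(⌊x⌋₊ : ℝ) - x| ≤ 1 :=
    abs_le.2 ⟨by linarith [Nat.lt_floor_add_one x], by linarith [Nat.floor_le h0]⟩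
  exact div_le_div_of_nonneg_right (by nlinarith [Real.two_pi_pos]) hm'.le

theorem exists_abs_sub_int_mul_pi_le {y : ℝ} (hy : |y| < Real.pi) :
    ∃ c ∈ ({-1, 0, 1} : Finset ℤ), 2 / Real.pi * |y - c * Real.pi| ≤ |Real.sin y| := by
  obtain ⟨h1, h2⟩ := abs_lt.1 hy
  by_cases h : |y| ≤ Real.pi / 2
  · exact ⟨0, by simp, by simpa using Real.mul_abs_le_abs_sin h⟩
  · rcases le_total 0 y with h0 | h0
    · rw [abs_of_nonneg h0, not_le] at h
      refine ⟨1, by simp, ?_⟩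
      have := Real.mul_abs_le_abs_sin (x := y - Real.pi)
        (abs_le.2 ⟨by linarith, by linarith⟩)
      rw [Real.sin_sub_pi, abs_neg] at this
      simpa using this
    · rw [abs_of_nonpos h0, not_le] at h
      refine ⟨-1, by simp, ?_⟩
      have := Real.mul_abs_le_abs_sin (x := y + Real.pi)
        (abs_le.2 ⟨by linarith, by linarith⟩)
      rw [Real.sin_add_pi, abs_neg] at this
      simpa using this

theorem card_filter_norm_one_sub_exp_pow_mul_lt {m : ℕ} (hm : 0 < m) {z : ℂ} (hz : ‖z‖ = 1)
    {T : ℝ} (hT : 0 ≤ T) :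
    (((Finset.range m).filter fun j : ℕ =>
      ‖1 - Complex.exp (2 * Real.pi * Complex.I / m) ^ j * z‖ < T).card : ℝ) ≤
      3 / 2 * (m * T) + 3 := by
  obtain ⟨x, h0, h1, hx⟩ := exists_exp_pow_mul_eq hm hz
  have hm' : (0 : ℝ) < m := Nat.cast_pos.2 hm
  have hpi := Real.pi_pos
  -- Indices wrap around modulo `m`, so those near `x` may lie near `x - m`, `x` or `x + m`. A chord
  -- is at least `4/m` times the index distance, hence the radius `m T / 4`; three intervals give
  -- `3/2 (m T) + 3`.
  have hsub : ((Finset.range m).filter fun j : ℕ =>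
      ‖1 - Complex.exp (2 * Real.pi * Complex.I / m) ^ j * z‖ < T) ⊆
      ({-1, 0, 1} : Finset ℤ).biUnion fun c => (Finset.range m).filter fun j : ℕ =>
        |(j : ℝ) - (x + c * m)| ≤ m * T / 4 := by
    intro j hj
    obtain ⟨hjm, hj⟩ := Finset.mem_filter.1 hj
    have hjm' : (j : ℝ) < m := Nat.cast_lt.2 (Finset.mem_range.1 hjm)
    have hj0 : (0 : ℝ) ≤ j := Nat.cast_nonneg j
    rw [hx, norm_sub_rev, Complex.norm_exp_I_mul_ofReal_sub_one, norm_mul, Real.norm_eq_abs,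
      Real.norm_eq_abs, abs_two] at hj
    have hy : |2 * Real.pi * (j - x) / m / 2| < Real.pi := by
      have : 2 * Real.pi * (j - x) / m / 2 = Real.pi * ((j - x) / m) := by ring
      rw [this, abs_mul, abs_of_pos hpi]
      have : |(j - x) / m| < 1 := by
        rw [abs_div, abs_of_pos hm', div_lt_one hm', abs_lt]
        exact ⟨by linarith, by linarith⟩
      nlinarith
    obtain ⟨c, hc, hcs⟩ := exists_abs_sub_int_mul_pi_le hy
    refine Finset.mem_biUnion.2 ⟨c, hc, Finset.mem_filter.2 ⟨hjm, ?_⟩⟩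
    have h3 : 2 * Real.pi * (j - x) / m / 2 - c * Real.pi =
        Real.pi / m * (j - (x + c * m)) := by field_simp; ring
    rw [h3, abs_mul, abs_of_pos (by positivity), ← mul_assoc] at hcs
    have h4 : 2 / Real.pi * (Real.pi / m) = 2 / m := by field_simp
    rw [h4, div_mul_eq_mul_div, div_le_iff₀ hm'] at hcs
    nlinarith
  have h5 := (Finset.card_le_card hsub).trans Finset.card_biUnion_le
  have h6 : (((Finset.range m).filter fun j : ℕ =>
      ‖1 - Complex.exp (2 * Real.pi * Complex.I / m) ^ j * z‖ < T).card : ℝ) ≤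
      ∑ c ∈ ({-1, 0, 1} : Finset ℤ), (2 * (m * T / 4) + 1) := by
    refine (Nat.cast_le.2 h5).trans ?_
    push_cast
    exact Finset.sum_le_sum fun c _ => card_filter_abs_natCast_sub_le m _ (by positivity)
  refine h6.trans ?_
  rw [Finset.sum_const]
  simp
  linarith

/-! ### The quotient and the product over rotations -/

theorem norm_one_sub_inv_mul_boundaryContactMap_le {m : ℕ} (hm : 0 < m) {z : ℂ} (hz : ‖z‖ ≤ 1) :
    ‖(1 - (m : ℂ)⁻¹) * boundaryContactMap z‖ ≤ 1 - (m : ℝ)⁻¹ := by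
  have h1 : (m : ℝ)⁻¹ ≤ 1 := inv_le_one_of_one_le₀ (by exact_mod_cast hm)
  have h2 : ‖(1 - (m : ℂ)⁻¹)‖ = 1 - (m : ℝ)⁻¹ := by
    have : (1 - (m : ℂ)⁻¹) = ((1 - (m : ℝ)⁻¹ : ℝ) : ℂ) := by push_cast; rfl
    rw [this, Complex.norm_real, Real.norm_of_nonneg (by linarith)]
  rw [norm_mul, h2]
  exact mul_le_of_le_one_right (by linarith) (norm_boundaryContactMap_le_one hz)

theorem norm_one_sub_inv_mul_boundaryContactMap_sub_one_le {m : ℕ} (hm : 14 ≤ m) {z : ℂ}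
    (hz : ‖z‖ = 1) (hz1 : ‖1 - z‖ ≤ 2 * Real.pi / m) :
    ‖(1 - (m : ℂ)⁻¹) * boundaryContactMap z - 1‖ ≤ 33 / m := by
  have hm' : (14 : ℝ) ≤ m := by exact_mod_cast hm
  have hm0 : (0 : ℝ) < m := by linarith
  -- `6.3` bounds `2π`, and `33 = 5 * 6.3 + 3/2` also covers the shift by `1/m`.
  have h7 : ‖1 - z‖ ≤ 6.3 / m := by
    refine hz1.trans (div_le_div_of_nonneg_right ?_ hm0.le)
    linarith [Real.pi_lt_d2]
  have h1 : 2 * ‖1 - z‖ ≤ 1 := by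
    have : 6.3 / (m : ℝ) ≤ 1 / 2 := by
      rw [div_le_div_iff₀ hm0 (by norm_num)]; linarith
    linarith
  have h2 := norm_boundaryContactMap_sub_one_le hz h1
  have h3 : (1 - (m : ℂ)⁻¹) * boundaryContactMap z - 1 =
      (boundaryContactMap z - 1) - (m : ℂ)⁻¹ * boundaryContactMap z := by ring
  rw [h3]
  refine (norm_sub_le _ _).trans ?_
  rw [norm_mul, norm_inv, Complex.norm_natCast]
  have h4 : (m : ℝ)⁻¹ * ‖boundaryContactMap z‖ ≤ (m : ℝ)⁻¹ :=
    mul_le_of_le_one_right (by positivity) (norm_boundaryContactMap_le_one hz.le)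
  have h5 : (33 : ℝ) / m = 5 * (6.3 / m) + 3 / 2 * (m : ℝ)⁻¹ := by ring
  have : 0 < (m : ℝ)⁻¹ := by positivity
  linarith

/-- `A` may vanish on the unit circle; the factor `1 - 1/m` keeps the argument inside, where `‖A‖ ≥
1/m`. -/
theorem diffContOnCl_quotient_comp_boundaryContactMap {q A : ℂ → ℂ} (hq : Differentiable ℂ q)
    (hA : Differentiable ℂ A) (hA1 : ∀ w, ‖w‖ < 1 → 1 - ‖w‖ ≤ ‖A w‖) {m : ℕ} (hm : 0 < m) :
    DiffContOnCl ℂ (fun z => q ((1 - (m : ℂ)⁻¹) * boundaryContactMap z) /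
      A ((1 - (m : ℂ)⁻¹) * boundaryContactMap z)) (Metric.ball 0 1) := by
  have hne : ∀ z : ℂ, ‖z‖ ≤ 1 → A ((1 - (m : ℂ)⁻¹) * boundaryContactMap z) ≠ 0 := by
    intro z hz h
    have h1 := norm_one_sub_inv_mul_boundaryContactMap_le hm hz
    have h2 : 0 < (m : ℝ)⁻¹ := by positivity
    have h3 := hA1 _ (h1.trans_lt (by linarith))
    rw [h, norm_zero] at h3
    linarith
  have hd := diffContOnCl_boundaryContactMap
  constructor
  · have hW := hd.differentiableOn.const_mul (1 - (m : ℂ)⁻¹)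
    refine (hq.comp_differentiableOn hW).div (hA.comp_differentiableOn hW) fun z hz => hne z ?_
    simpa using (Metric.mem_ball.1 hz).le
  · have hW := hd.continuousOn.const_mul (1 - (m : ℂ)⁻¹)
    refine (hq.continuous.comp_continuousOn hW).div (hA.continuous.comp_continuousOn hW)
      fun z hz => hne z ?_
    rw [closure_ball _ one_ne_zero] at hz
    simpa using hz

theorem norm_le_one_add_inv_of_norm_sub_le {x y : ℂ} {m : ℝ} (hm : 0 < m) (hy : m⁻¹ ≤ ‖y‖)
    (h : ‖x - y‖ ≤ (m ^ 2)⁻¹) : ‖x / y‖ ≤ 1 + m⁻¹ := by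
  have hm1 : 0 < m⁻¹ := by positivity
  have hypos : 0 < ‖y‖ := hm1.trans_le hy
  rw [norm_div, div_le_iff₀ hypos]
  have h1 : ‖x‖ ≤ ‖x - y‖ + ‖y‖ := by simpa using norm_add_le (x - y) y
  have h2 : (m ^ 2)⁻¹ = m⁻¹ * m⁻¹ := by rw [sq, mul_inv]
  nlinarith

/-- If `∏ b j` splits into one factor bounded by `L * Q`, some factors bounded by `Q`, and factors
bounded by `(1 + 1 / m) ^ 4`, then the product is bounded accordingly. -/
theorem prod_range_le_of_split {m N : ℕ} {b : ℕ → ℝ} (hb : ∀ j, 0 ≤ b j) {L Q : ℝ} (hL : 0 ≤ L)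
    (hQ : 1 ≤ Q) (P : ℕ → Prop) [DecidablePred P] (hN : ((Finset.range m).filter P).card ≤ N)
    (hall : ∀ j, b j ≤ Q) (hnot : ∀ j, ¬ P j → b j ≤ (1 + (m : ℝ)⁻¹) ^ 4) {j₀ : ℕ} (hj₀ : j₀ < m)
    (hP : P j₀) (hbj₀ : b j₀ ≤ L * Q) :
    ∏ j ∈ Finset.range m, b j ≤ L * Q ^ N * Real.exp 4 := by
  rw [← Finset.prod_filter_mul_prod_filter_not (Finset.range m) P]
  have hmem : j₀ ∈ (Finset.range m).filter P :=
    Finset.mem_filter.2 ⟨Finset.mem_range.2 hj₀, hP⟩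
  have hQ0 : 0 ≤ Q := zero_le_one.trans hQ
  have h1 : ∏ j ∈ (Finset.range m).filter P, b j ≤ L * Q ^ N := by
    rw [← Finset.mul_prod_erase _ _ hmem]
    have h2 : ∏ j ∈ ((Finset.range m).filter P).erase j₀, b j ≤
        Q ^ (((Finset.range m).filter P).card - 1) := by
      rw [← Finset.card_erase_of_mem hmem]
      exact (Finset.prod_le_prod (fun j _ => hb j) fun j _ => hall j).trans_eq
        (Finset.prod_const _)
    have hc : 1 ≤ ((Finset.range m).filter P).card := Finset.card_pos.2 ⟨j₀, hmem⟩
    calc _ ≤ (L * Q) * Q ^ (((Finset.range m).filter P).card - 1) :=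
          mul_le_mul hbj₀ h2 (Finset.prod_nonneg fun j _ => hb j) (by positivity)
      _ = L * Q ^ ((Finset.range m).filter P).card := by
          rw [mul_assoc, ← pow_succ', Nat.sub_add_cancel hc]
      _ ≤ _ := by gcongr
  have h3 : ∏ j ∈ (Finset.range m).filter (fun j => ¬ P j), b j ≤ Real.exp 4 := by
    have hm0 : (m : ℝ) ≠ 0 := Nat.cast_ne_zero.2 (by omega)
    have h4 : (1 + (m : ℝ)⁻¹) ^ 4 ≤ Real.exp (4 * (m : ℝ)⁻¹) := by
      have := Real.add_one_le_exp (m : ℝ)⁻¹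
      rw [show (4 : ℝ) * (m : ℝ)⁻¹ = ((4 : ℕ) : ℝ) * (m : ℝ)⁻¹ by norm_num, Real.exp_nat_mul]
      exact pow_le_pow_left₀ (by positivity) (by linarith) 4
    calc _ ≤ ∏ j ∈ (Finset.range m).filter (fun j => ¬ P j), Real.exp (4 * (m : ℝ)⁻¹) :=
          Finset.prod_le_prod (fun j _ => hb j)
            fun j hj => (hnot j (Finset.mem_filter.1 hj).2).trans h4
      _ = Real.exp (4 * (m : ℝ)⁻¹) ^ ((Finset.range m).filter (fun j => ¬ P j)).card :=
          Finset.prod_const _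
      _ ≤ Real.exp (4 * (m : ℝ)⁻¹) ^ m := by
          refine pow_le_pow_right₀ (Real.one_le_exp (by positivity)) ?_
          simpa using Finset.card_filter_le (Finset.range m) (fun j => ¬ P j)
      _ = Real.exp 4 := by rw [← Real.exp_nat_mul]; congr 1; field_simp
  exact mul_le_mul h1 h3 (Finset.prod_nonneg fun j _ => hb j) (by positivity)

/-- A lower bound for the maximum `L` of `‖q‖` over a short arc around `1`, when `q` is close to a
zero-free function `A` away from the unit circle. -/
theorem one_le_mul_of_close_to_zero_free {q A : ℂ → ℂ} (hq : Differentiable ℂ q)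
    (hA : Differentiable ℂ A) (hA1 : ∀ w, ‖w‖ < 1 → 1 - ‖w‖ ≤ ‖A w‖) (h0 : q 0 = A 0)
    {K L a T : ℝ} (hK1 : 1 ≤ K) (hK : ∀ w, ‖w‖ ≤ 1 → ‖q w‖ ≤ K) (hL0 : 0 ≤ L)
    (hL : ∀ v : ℂ, ‖v‖ = 1 → ‖v - 1‖ ≤ a → ‖q v‖ ≤ L) {m N : ℕ} (hm : 14 ≤ m)
    (hma : 99 / m ≤ a) (hmT : 7 / m ≤ T) (hT1 : T ≤ 1) (hN : 3 / 2 * (m * T) + 3 ≤ (N : ℝ))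
    (hB : ∀ w, ‖w‖ ≤ Real.exp (-(3 / 4 * T / ((3 - Real.log T) ^ 2 + 10))) →
      ‖q w - A w‖ ≤ ((m : ℝ) ^ 2)⁻¹) :
    1 ≤ L * ((K * m) ^ 4) ^ N * Real.exp 4 := by
  have hm0 : 0 < m := by omega
  have hm' : (14 : ℝ) ≤ m := by exact_mod_cast hm
  have hmpos : (0 : ℝ) < m := by linarith
  have hT0 : 0 < T := lt_of_lt_of_le (by positivity) hmT
  set ω : ℂ := Complex.exp (2 * Real.pi * Complex.I / m)
  have hω : ∀ j : ℕ, ‖ω ^ j‖ = 1 := by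
    intro j
    have : 2 * Real.pi * Complex.I / m = ((2 * Real.pi / m : ℝ) : ℂ) * Complex.I := by
      push_cast; ring
    simp only [ω]
    rw [norm_pow, this, Complex.norm_exp_ofReal_mul_I, one_pow]
  set W : ℂ → ℂ := fun z => (1 - (m : ℂ)⁻¹) * boundaryContactMap z
  set F : ℂ → ℂ := fun z => q (W z) / A (W z) with hF
  have hW : ∀ z : ℂ, ‖z‖ ≤ 1 → ‖W z‖ ≤ 1 - (m : ℝ)⁻¹ := fun z hz =>
    norm_one_sub_inv_mul_boundaryContactMap_le hm0 hz
  have hmi : 0 < (m : ℝ)⁻¹ := by positivity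
  have hAW : ∀ z : ℂ, ‖z‖ ≤ 1 → (m : ℝ)⁻¹ ≤ ‖A (W z)‖ := by
    intro z hz
    have := hW z hz
    linarith [hA1 (W z) (by linarith)]
  have hFd : DiffContOnCl ℂ F (Metric.ball 0 1) :=
    diffContOnCl_quotient_comp_boundaryContactMap hq hA hA1 hm0
  have hFQ : ∀ z : ℂ, ‖z‖ ≤ 1 → ‖F z‖ ≤ ‖q (W z)‖ * m := by
    intro z hz
    rw [hF, norm_div, div_eq_mul_inv]
    gcongr
    exact inv_le_of_inv_le₀ hmpos (hAW z hz)
  have hF1 : ∀ z : ℂ, ‖z‖ = 1 → ‖F z‖ ^ 4 ≤ (K * m) ^ 4 := by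
    intro z hz
    refine pow_le_pow_left₀ (norm_nonneg _) ((hFQ z hz.le).trans ?_) 4
    gcongr
    exact hK _ (by linarith [hW z hz.le])
  have hF2 : ∀ z : ℂ, ‖z‖ = 1 → ‖1 - z‖ ≤ 2 * Real.pi / m → ‖F z‖ ^ 4 ≤ L * (K * m) ^ 4 := by
    intro z hz hz1
    have h1 := norm_one_sub_inv_mul_boundaryContactMap_sub_one_le hm hz hz1
    have h2 := norm_pow_four_le_of_arc_bound hq hK hL (w := W z) (by linarith [hW z hz.le]) (by
      refine le_trans ?_ hma
      calc 3 * ‖W z - 1‖ ≤ 3 * (33 / m) := by gcongr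
        _ = 99 / m := by ring)
    calc ‖F z‖ ^ 4 ≤ (‖q (W z)‖ * m) ^ 4 := pow_le_pow_left₀ (norm_nonneg _) (hFQ z hz.le) 4
      _ = ‖q (W z)‖ ^ 4 * m ^ 4 := mul_pow _ _ _
      _ ≤ L * K ^ 3 * m ^ 4 := by gcongr
      -- The spare factor `K ≥ 1` lets this bound share `Q = (K m)^4` with the crude one.
      _ ≤ L * K ^ 4 * m ^ 4 := by gcongr; norm_num
      _ = _ := by ring
  have hF3 : ∀ z : ℂ, ‖z‖ = 1 → ¬ ‖1 - z‖ < T → ‖F z‖ ^ 4 ≤ (1 + (m : ℝ)⁻¹) ^ 4 := by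
    intro z hz hz1
    refine pow_le_pow_left₀ (norm_nonneg _) ?_ 4
    refine norm_le_one_add_inv_of_norm_sub_le hmpos (hAW z hz.le) (hB _ ?_)
    have h1 : ‖(1 - (m : ℂ)⁻¹)‖ ≤ 1 := by
      have : (1 - (m : ℂ)⁻¹) = ((1 - (m : ℝ)⁻¹ : ℝ) : ℂ) := by push_cast; rfl
      have h1 : (m : ℝ)⁻¹ ≤ 1 := inv_le_one_of_one_le₀ (by linarith)
      rw [this, Complex.norm_real, Real.norm_of_nonneg (by linarith)]
      linarith
    refine le_trans ?_ (norm_boundaryContactMap_le_exp hz hT0 hT1 (not_lt.1 hz1))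
    rw [norm_mul]
    exact mul_le_of_le_one_left (norm_nonneg _) h1
  -- The fourth powers match the fourth power in the arc bound.
  set G : ℂ → ℂ := fun z => ∏ j ∈ Finset.range m, F (ω ^ j * z) ^ 4 with hG
  have hGd : DiffContOnCl ℂ G (Metric.ball 0 1) := by
    have hb : ∀ j : ℕ, Set.MapsTo (fun z => ω ^ j * z) (Metric.ball (0 : ℂ) 1)
        (Metric.ball 0 1) := by
      intro j z hz
      simpa [hω j, -norm_pow] using hz
    have hc : ∀ j : ℕ, DiffContOnCl ℂ (fun z => F (ω ^ j * z)) (Metric.ball 0 1) := fun j =>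
      hFd.comp (g := fun z => ω ^ j * z)
        (Differentiable.diffContOnCl (by fun_prop)) (hb j)
    constructor
    · exact DifferentiableOn.fun_finsetProd fun j _ => (hc j).differentiableOn.pow 4
    · exact continuousOn_finsetProd _ fun j _ => (hc j).continuousOn.pow 4
  have hG0 : G 0 = 1 := by
    have hA0 : A 0 ≠ 0 := by
      intro h
      have := hA1 0 (by simp)
      rw [h] at this
      simp at this
      linarith
    simp [hG, hF, W, boundaryContactMap_zero, h0, hA0]
  have hmax : ‖G 0‖ ≤ L * ((K * m) ^ 4) ^ N * Real.exp 4 := by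
    refine Complex.norm_le_of_forall_mem_frontier_norm_le Metric.isBounded_ball hGd
      (fun z hz => ?_) (subset_closure (by simp))
    rw [frontier_ball _ one_ne_zero] at hz
    have hz : ‖z‖ = 1 := by simpa using hz
    have hz' : ∀ j : ℕ, ‖ω ^ j * z‖ = 1 := fun j => by rw [norm_mul, hω, hz, one_mul]
    obtain ⟨j₀, hj₀, hj₀'⟩ := exists_norm_one_sub_exp_pow_mul_le hm0 hz
    simp only [hG, norm_prod, norm_pow]
    refine prod_range_le_of_split (b := fun j => ‖F (ω ^ j * z)‖ ^ 4) (fun j => by positivity)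
      hL0 ?_ (fun j : ℕ => ‖1 - ω ^ j * z‖ < T) ?_ (fun j => hF1 _ (hz' j))
      (fun j hj => hF3 _ (hz' j) hj) hj₀ ?_ (hF2 _ (hz' j₀) hj₀')
    · exact one_le_pow₀ (one_le_mul_of_one_le_of_one_le hK1 (by linarith))
    · exact Nat.cast_le.1 ((card_filter_norm_one_sub_exp_pow_mul_lt hm0 hz hT0.le).trans hN)
    · refine hj₀'.trans_lt (lt_of_lt_of_le ?_ hmT)
      gcongr
      linarith [Real.pi_lt_d2]
  rwa [hG0, norm_one] at hmax

/-! ### Choice of parameters for gap polynomials -/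

open Filter Topology

theorem norm_gap_sum_le {S : Finset ℕ} {n : ℕ} (hS : S ⊆ Finset.range (n + 1)) {a : ℕ → ℂ}
    (ha : ∀ j ∈ S, ‖a j‖ ≤ 1) {w : ℂ} {c : ℝ} (hc : ∀ j ∈ S, ‖w‖ ^ j ≤ c) (hc0 : 0 ≤ c) :
    ‖∑ j ∈ S, a j * w ^ j‖ ≤ (n + 1) * c := by
  have h1 : (S.card : ℝ) ≤ n + 1 := by
    have := Finset.card_le_card hS
    rw [Finset.card_range] at this
    exact_mod_cast this
  calc ‖∑ j ∈ S, a j * w ^ j‖ ≤ ∑ _j ∈ S, c := norm_sum_le_of_le _ fun j hj => by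
        rw [norm_mul, norm_pow]
        exact (mul_le_of_le_one_left (by positivity) (ha j hj)).trans (hc j hj)
    _ = S.card * c := by rw [Finset.sum_const, nsmul_eq_mul]
    _ ≤ _ := by gcongr

theorem abs_arg_le_of_norm_eq_one {v : ℂ} (hv : ‖v‖ = 1) :
    |v.arg| ≤ Real.pi / 2 * ‖v - 1‖ := by
  have h1 : Complex.exp (Complex.I * v.arg) = v := by
    have := Complex.norm_mul_exp_arg_mul_I v
    rwa [hv, Complex.ofReal_one, one_mul, mul_comm] at this
  have h2 : ‖v - 1‖ = 2 * |Real.sin (v.arg / 2)| := by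
    conv_lhs => rw [← h1]
    rw [Complex.norm_exp_I_mul_ofReal_sub_one, norm_mul, Real.norm_eq_abs, Real.norm_eq_abs,
      abs_two]
  have hpi := Real.pi_pos
  have h3 := Real.mul_abs_le_abs_sin (x := v.arg / 2) (by
    rw [abs_div, abs_two]; linarith [Complex.abs_arg_le_pi v])
  rw [abs_div, abs_two, div_mul_eq_mul_div, div_le_iff₀ hpi] at h3
  rw [h2]
  linarith

/-- With `x = n`, `(x + 3) m ≤ x^4` makes each crude factor at most `exp (16 l)`; then `16 * 306 =
4896`, and `5000` leaves room for the `4`. -/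
theorem exp_neg_le_of_one_le_mul {x l X M m : ℝ} {N : ℕ} (hX1 : 1 ≤ X) (hl1 : 1 ≤ l)
    (hx : 80802 ≤ x) (hexp : x = Real.exp l) (hm0 : 0 ≤ m) (hm : m ≤ 201 * x ^ 2)
    (hN : (N : ℝ) ≤ 306 * (X * l ^ 4)) (hM0 : 0 ≤ M)
    (key : 1 ≤ M * (((x + 3) * m) ^ 4) ^ N * Real.exp 4) :
    Real.exp (-5000 * X * l ^ 5) ≤ M := by
  have hl0 : 0 ≤ l := by linarith
  have hx0 : 0 ≤ x := by linarith
  have hQ : ((x + 3) * m) ^ 4 ≤ Real.exp (16 * l) := by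
    have h1 : (x + 3) * m ≤ x ^ 4 := by
      calc (x + 3) * m ≤ (2 * x) * (201 * x ^ 2) := by gcongr; linarith
        _ = 402 * x ^ 3 := by ring
        _ ≤ x * x ^ 3 := by gcongr; linarith
        _ = _ := by ring
    calc ((x + 3) * m) ^ 4 ≤ (x ^ 4) ^ 4 := by gcongr
      _ = Real.exp (16 * l) := by rw [hexp, ← pow_mul, ← Real.exp_nat_mul]; norm_num
  have h3 : (((x + 3) * m) ^ 4) ^ N * Real.exp 4 ≤ Real.exp (5000 * X * l ^ 5) := by
    calc (((x + 3) * m) ^ 4) ^ N * Real.exp 4 ≤ Real.exp (16 * l) ^ N * Real.exp 4 :=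
          mul_le_mul_of_nonneg_right (pow_le_pow_left₀ (by positivity) hQ N) (Real.exp_pos 4).le
      _ = Real.exp (N * (16 * l) + 4) := by rw [← Real.exp_nat_mul, ← Real.exp_add]
      _ ≤ _ := by
        rw [Real.exp_le_exp]
        have h1 : N * (16 * l) ≤ 306 * (X * l ^ 4) * (16 * l) :=
          mul_le_mul_of_nonneg_right hN (by positivity)
        have h2 : 1 ≤ X * l ^ 5 := one_le_mul_of_one_le_of_one_le hX1 (one_le_pow₀ hl1)
        have h4 : 306 * (X * l ^ 4) * (16 * l) = 4896 * (X * l ^ 5) := by ring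
        linarith
  rw [show -5000 * X * l ^ 5 = -(5000 * X * l ^ 5) by ring, Real.exp_neg,
    inv_le_iff_one_le_mul₀ (Real.exp_pos _)]
  rw [mul_assoc] at key
  exact key.trans (mul_le_mul_of_nonneg_left h3 hM0)

/-- The lower bound for gap polynomials, with explicit requirements on `n`. -/
theorem exp_neg_le_of_arc_bound {n : ℕ} {X l M : ℝ} (hX1 : 1 ≤ X) (hXn : X ≤ n)
    (hl : l = Real.log n) (hl16 : 16 ≤ l) (hlX : l ^ 4 ≤ X) (hn : 80802 ≤ n)
    {ζ η : ℂ} {d : ℕ} {a : ℕ → ℂ} {S : Finset ℕ} (hζ : ‖ζ‖ = 1) (hη : ‖η‖ ≤ 1) (hd : 1 ≤ d)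
    (hS : S ⊆ Finset.range (n + 1)) (hSX : ∀ j ∈ S, X ≤ j) (ha : ∀ j ∈ S, ‖a j‖ ≤ 1)
    {ρ : ℝ} (hρ0 : 0 ≤ ρ) (hρ1 : ρ ≤ 1)
    (hM : ∀ θ : ℝ, |θ| ≤ (X ^ 2)⁻¹ → ‖ζ - η * (ρ * Complex.exp (θ * Complex.I)) ^ d +
      ∑ j ∈ S, a j * (ρ * Complex.exp (θ * Complex.I)) ^ j‖ ≤ M) :
    Real.exp (-5000 * X * l ^ 5) ≤ M := by
  have hX0 : 0 < X := by linarith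
  have hl0 : 0 < l := by linarith
  have hl1 : 1 ≤ l ^ 4 := one_le_pow₀ (by linarith)
  have hn' : (80802 : ℝ) ≤ n := by exact_mod_cast hn
  have hn0 : (0 : ℝ) < n := by linarith
  have hexp : (n : ℝ) = Real.exp l := by rw [hl, Real.exp_log hn0]
  set T : ℝ := X⁻¹ * l ^ 4 with hT
  have hX2 : 1 ≤ X ^ 2 := one_le_pow₀ hX1
  -- `m ≥ 198 X²` is what `99 / m ≤ X⁻² / 2` requires.
  obtain ⟨m, hm1, hm2⟩ : ∃ m : ℕ, 200 * X ^ 2 ≤ m ∧ (m : ℝ) ≤ 201 * X ^ 2 :=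
    ⟨⌈200 * X ^ 2⌉₊, Nat.le_ceil _, by
      linarith [Nat.ceil_lt_add_one (a := 200 * X ^ 2) (by positivity)]⟩
  have hm0 : (0 : ℝ) < m := by linarith
  have hm3 : (m : ℝ) ≤ 201 * (n : ℝ) ^ 2 := hm2.trans (by gcongr)
  have hTX : X⁻¹ ≤ T := le_mul_of_one_le_right (by positivity) hl1
  have hT0 : 0 < T := by positivity
  have hT1 : T ≤ 1 := by
    rw [hT, inv_mul_le_iff₀ hX0, mul_one]; exact hlX
  obtain ⟨N, hN1, hN2⟩ : ∃ N : ℕ, 3 / 2 * (m * T) + 3 ≤ N ∧ (N : ℝ) ≤ 306 * (X * l ^ 4) := by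
    refine ⟨⌈3 / 2 * (m * T) + 3⌉₊, Nat.le_ceil _, ?_⟩
    have h1 := Nat.ceil_lt_add_one (a := 3 / 2 * (m * T) + 3) (by positivity)
    have h2 : m * T ≤ 201 * (X * l ^ 4) := by
      calc m * T ≤ 201 * X ^ 2 * T := by gcongr
        _ = _ := by rw [hT]; field_simp
    have h3 : 1 ≤ X * l ^ 4 := one_le_mul_of_one_le_of_one_le hX1 hl1
    linarith
  set q : ℂ → ℂ := fun w => ζ - η * (ρ * w) ^ d + ∑ j ∈ S, a j * (ρ * w) ^ j with hq
  set A : ℂ → ℂ := fun w => ζ - η * (ρ * w) ^ d with hA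
  have hρw : ∀ w : ℂ, ‖(ρ : ℂ) * w‖ ≤ ‖w‖ := by
    intro w
    rw [norm_mul, Complex.norm_real, Real.norm_of_nonneg hρ0]
    exact mul_le_of_le_one_left (norm_nonneg _) hρ1
  have hηw : ∀ w : ℂ, ‖w‖ ≤ 1 → ‖η * (ρ * w) ^ d‖ ≤ ‖w‖ := by
    intro w hw
    rw [norm_mul, norm_pow]
    calc ‖η‖ * ‖(ρ : ℂ) * w‖ ^ d ≤ 1 * ‖w‖ ^ d := by gcongr; exact hρw w
      _ ≤ ‖w‖ := by rw [one_mul]; exact pow_le_of_le_one (norm_nonneg _) hw (by omega)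
  have hS0 : ∀ j ∈ S, j ≠ 0 := by
    rintro j hj rfl
    have := hSX 0 hj
    simp at this
    linarith
  have hd0 : d ≠ 0 := by omega
  have hK : ∀ w, ‖w‖ ≤ 1 → ‖q w‖ ≤ n + 3 := by
    intro w hw
    have h1 := norm_gap_sum_le hS ha (w := ρ * w) (c := 1)
      (fun j _ => pow_le_one₀ (norm_nonneg _) ((hρw w).trans hw)) zero_le_one
    have h2 : ‖ζ - η * (ρ * w) ^ d‖ ≤ 2 := by
      refine (norm_sub_le _ _).trans ?_
      linarith [hηw w hw]
    refine (norm_add_le _ _).trans ?_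
    linarith
  have hL : ∀ v : ℂ, ‖v‖ = 1 → ‖v - 1‖ ≤ (X ^ 2)⁻¹ / 2 → ‖q v‖ ≤ M := by
    intro v hv hv1
    have h1 : Complex.exp (v.arg * Complex.I) = v := by
      have := Complex.norm_mul_exp_arg_mul_I v
      rwa [hv, Complex.ofReal_one, one_mul] at this
    have h2 := hM v.arg (by
      refine (abs_arg_le_of_norm_eq_one hv).trans ?_
      have : 0 < (X ^ 2)⁻¹ := by positivity
      nlinarith [Real.pi_lt_d2, Real.pi_pos, norm_nonneg (v - 1)])
    rwa [h1] at h2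
  have hM0 : 0 ≤ M := (norm_nonneg _).trans (hL 1 (by simp) (by simp; positivity))
  have hB : ∀ w, ‖w‖ ≤ Real.exp (-(3 / 4 * T / ((3 - Real.log T) ^ 2 + 10))) →
      ‖q w - A w‖ ≤ ((m : ℝ) ^ 2)⁻¹ := by
    intro w hw
    set δ := 3 / 4 * T / ((3 - Real.log T) ^ 2 + 10) with hδ
    have hδ0 : 0 ≤ δ := by positivity
    -- `T = l^4 / X` yields `δ X ≥ 3/8 l²`, which is at least `6 l` exactly because `l ≥ 16`. The
    -- gap sum is then at most `(n + 1) n⁻⁶`, below `m⁻²` once `n ≥ 80802 = 2 * 201²`.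
    have hδX : 6 * l ≤ δ * X := by
      have hlT0 : Real.log T ≤ 0 := Real.log_nonpos hT0.le hT1
      have hlT : -l ≤ Real.log T := by
        rw [hl, ← Real.log_inv]
        refine Real.log_le_log (by positivity) (le_trans ?_ hTX)
        gcongr
      have h1 : (3 - Real.log T) ^ 2 + 10 ≤ 2 * l ^ 2 := by
        have : (3 - Real.log T) ^ 2 ≤ (3 + l) ^ 2 :=
          pow_le_pow_left₀ (by linarith) (by linarith) 2
        nlinarith
      have h2 : 3 / 4 * T / (2 * l ^ 2) ≤ δ := by rw [hδ]; gcongr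
      have h3 : 3 / 4 * T / (2 * l ^ 2) * X = 3 / 8 * l ^ 2 := by
        rw [hT]; field_simp; ring
      nlinarith
    have h1 : ‖q w - A w‖ ≤ (n + 1) * Real.exp (-(6 * l)) := by
      have : q w - A w = ∑ j ∈ S, a j * (ρ * w) ^ j := by simp [hq, hA]
      rw [this]
      refine norm_gap_sum_le hS ha (fun j hj => ?_) (Real.exp_pos _).le
      calc ‖(ρ : ℂ) * w‖ ^ j ≤ Real.exp (-δ) ^ j := by gcongr; exact (hρw w).trans hw
        _ = Real.exp (-(j * δ)) := by rw [← Real.exp_nat_mul]; congr 1; ring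
        _ ≤ _ := by
          rw [Real.exp_le_exp]
          have := mul_le_mul_of_nonneg_right (hSX j hj) hδ0
          linarith
    refine h1.trans ?_
    have h2 : Real.exp (-(6 * l)) = ((n : ℝ) ^ 6)⁻¹ := by
      rw [hexp, ← Real.exp_nat_mul, ← Real.exp_neg]; norm_num
    rw [h2, ← div_eq_mul_inv, div_le_iff₀ (by positivity), ← div_eq_inv_mul,
      le_div_iff₀ (by positivity)]
    calc ((n : ℝ) + 1) * m ^ 2 ≤ (2 * n) * (201 * (n : ℝ) ^ 2) ^ 2 := by
          gcongr; linarith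
      _ = 80802 * (n : ℝ) ^ 5 := by ring
      _ ≤ n * (n : ℝ) ^ 5 := by gcongr
      _ = _ := by ring
  have key := one_le_mul_of_close_to_zero_free (q := q) (A := A) (K := n + 3) (L := M)
    (a := (X ^ 2)⁻¹ / 2) (T := T) (m := m) (N := N) (by fun_prop) (by fun_prop)
    (fun w hw => by
      have h1 := norm_sub_norm_le ζ (η * (ρ * w) ^ d)
      have h2 := hηw w hw.le
      simp only [hA]
      linarith) (by
      simp only [hq, hA, add_eq_left]
      exact Finset.sum_eq_zero fun j hj => by simp [hS0 j hj])
    (by linarith) hK hM0 hL (by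
      have : (14 : ℝ) ≤ m := by linarith
      exact_mod_cast this)
    (by
      rw [div_le_iff₀ hm0, inv_div_left, ← div_eq_inv_mul, le_div_iff₀ (by positivity)]
      linarith)
    (by
      refine le_trans ?_ hTX
      rw [div_le_iff₀ hm0, ← div_eq_inv_mul, le_div_iff₀ hX0]
      nlinarith) hT1 hN1 hB
  exact exp_neg_le_of_one_le_mul hX1 (by linarith) hn' hexp hm0.le hm3 hN2 hM0 key

theorem mainTheorem4 (μ : ℝ) (hμ0 : 0 < μ) (hμ1 : μ < 1) :
    ∃ C : ℝ, 0 < C ∧ ∃ N : ℕ, ∀ n : ℕ, N ≤ n →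
      ∀ p ∈ gapPolynomials μ n, ∀ ρ ∈ Set.Icc (0 : ℝ) 1,
        ∃ M : ℝ,
          IsGreatest
            ((fun θ : ℝ => ‖p.eval ((ρ : ℂ) * Complex.exp ((θ : ℂ) * Complex.I))‖) ''
              {θ : ℝ | |θ| ≤ (n : ℝ) ^ (-2 * μ)}) M ∧
          Real.exp (-C * (n : ℝ) ^ μ * Real.log (n : ℝ) ^ 5) ≤ M := by
  refine ⟨5000, by norm_num, ?_⟩
  have hlog : ∀ᶠ n : ℕ in atTop, 16 ≤ Real.log (n : ℝ) :=
    (Real.tendsto_log_atTop.comp tendsto_natCast_atTop_atTop).eventually_ge_atTop 16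
  -- This is the condition `T ≤ 1`.
  have hlogX : ∀ᶠ n : ℕ in atTop, Real.log (n : ℝ) ^ 4 ≤ (n : ℝ) ^ μ := by
    have h1 := (isLittleO_log_rpow_rpow_atTop (4 : ℝ) hμ0).bound one_pos
    have h2 := tendsto_natCast_atTop_atTop (R := ℝ) |>.eventually h1
    filter_upwards [h2, hlog] with n hn hn2
    have h3 : (0 : ℝ) ≤ (n : ℝ) ^ μ := by positivity
    rw [one_mul, Real.norm_of_nonneg h3] at hn
    have := (le_abs_self _).trans hn
    exact_mod_cast this
  obtain ⟨N, hN⟩ := eventually_atTop.1 (hlog.and (hlogX.and (eventually_ge_atTop 80802)))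
  refine ⟨N, fun n hn p hp ρ hρ => ?_⟩
  obtain ⟨hl, hlX, hn1⟩ := hN n hn
  have hn1' : (1 : ℝ) ≤ n := by exact_mod_cast (by omega : 1 ≤ n)
  have hpow : (n : ℝ) ^ (-2 * μ) = (((n : ℝ) ^ μ) ^ 2)⁻¹ := by
    rw [← Real.rpow_natCast, ← Real.rpow_mul (by linarith), ← Real.rpow_neg (by linarith)]
    congr 1; push_cast; ring
  have hset : {θ : ℝ | |θ| ≤ (n : ℝ) ^ (-2 * μ)} =
      Set.Icc (-(n : ℝ) ^ (-2 * μ)) ((n : ℝ) ^ (-2 * μ)) := by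
    ext θ; simp [abs_le]
  have hpos : (0 : ℝ) ≤ (n : ℝ) ^ (-2 * μ) := by positivity
  have hcont : Continuous fun θ : ℝ =>
      ‖p.eval ((ρ : ℂ) * Complex.exp ((θ : ℂ) * Complex.I))‖ :=
    (p.continuous.comp (by fun_prop)).norm
  have hcomp : IsCompact {θ : ℝ | |θ| ≤ (n : ℝ) ^ (-2 * μ)} := by rw [hset]; exact isCompact_Icc
  obtain ⟨M, hM⟩ := (hcomp.image hcont).exists_isGreatest (Set.Nonempty.image _ ⟨0, by simpa only [Set.mem_ofPred_eq, abs_zero]⟩)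
  refine ⟨M, hM, ?_⟩
  obtain ⟨ζ, η, d, a, hζ, hη, hd, ha, rfl⟩ := hp
  have hη1 : ‖η‖ ≤ 1 := by rcases hη with rfl | rfl <;> simp
  refine exp_neg_le_of_arc_bound (a := a) (X := (n : ℝ) ^ μ) (Real.one_le_rpow hn1' hμ0.le) ?_ rfl hl hlX
    hn1 hζ hη1 hd (Finset.filter_subset _ _)
    (fun j hj => (Finset.mem_filter.1 hj).2) (fun j hj => ?_) hρ.1 hρ.2 fun θ hθ => ?_
  · simpa using Real.rpow_le_rpow_of_exponent_le hn1' hμ1.le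
  · obtain ⟨h1, h2⟩ := Finset.mem_filter.1 hj
    exact ha j h2 (by simpa [Nat.lt_succ_iff] using h1)
  · have := hM.2 (Set.mem_image_of_mem _ (by rw [← hpow] at hθ; exact hθ))
    simpa [Polynomial.eval_finsetSum] using this
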